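/- Let $M$ be a cotransversal matroid on a finite ground set $E$, i.e. a matroid whose dual $M^*$ is transversal, and let $r$ be the rank of $M^*$. A presentation of $M^*$ is a finite family $(A_1,\dots,A_m)$ of subsets of $E$ such that the independent sets of $M^*$ are exactly the partial transversals of the family (the sets $\{e_1,\dots,e_k\}$ of distinct elements with $e_i\in A_{j_i}$ for distinct indices $j_1,\dots,j_k$). Then $M^*$ has a presentation with exactly $r$ members, and the following holds for every presentation $(A_1,\dots,A_r)$ of $M^*$ with exactly $r$ members. For $I\subseteq[r]$ let $l_I$ be the number of $e\in E$ with $\{j: e\in A_j\}=I$, let $\Delta_{\{0\}\cup I}\subset\mathbb R^r$ be the convex hull of the origin and the unit vectors $e_i$, $i\in I$, and let $$P_{M^*}=\sum_{I\subseteq[r]} l_I\,\Delta_{\{0\}\cup I}$$ (Minkowski sum) be the transversalhedron. Let $X$ be the set of monomials $x_1^{c_1-1}\cdots x_r^{c_r-1}$, where $(c_1,\dots,c_r)$ runs over the lattice points of $P_{M^*}$ lying on none of the coordinate hyperplanes $x_i=0$. Then $X$ is a pure monomial order ideal, i.e. a finite set of monomials that contains every divisor of each of its members and all of whose maximal members under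 divisibility have the same degree. Moreover its degree sequence is the $h$-vector of $M$: for every $k\ge 0$ the number of monomials of degree $k$ in $X$ equals $h_k$, where, with $d$ the rank of $M$ and $f_{i-1}$ the number of $i$-element independent sets of $M$, the $h_k$ are defined by $\sum_k h_kx^k=\sum_{i=0}^{d} f_{i-1}x^i(1-x)^{d-i}$ (so $h_k=0$ for $k>d$). -/

import Mathlib

open scoped Pointwise

noncomputable section

namespace Cotransversal

/-- The family `A = (A_1, …, A_m)` of subsets of the ground set is a presentation of `N`:
the independent sets of `N` are the partial transversals of `A`, that is, the sets of
left-hand vertices of matchings in the bipartite graph with an edge `(e, j)` whenever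
`e ∈ A j`. -/
def IsPresentation {α : Type*} (N : Matroid α) {m : ℕ} (A : Fin m → Set α) : Prop :=
  (∀ j, A j ⊆ N.E) ∧
    ∀ I : Set α, N.Indep I ↔ ∃ f : I → Fin m, Function.Injective f ∧ ∀ e : I, (e : α) ∈ A (f e)

/-- A transversal matroid: one with a presentation by finitely many sets. -/
def IsTransversal {α : Type*} (N : Matroid α) : Prop :=
  ∃ (m : ℕ) (A : Fin m → Set α), IsPresentation N A

/-- A cotransversal matroid: its dual is transversal. -/
def IsCotransversal {α : Type*} (M : Matroid α) : Prop :=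
  IsTransversal (Matroid.dual M)

/-- The number `l_I` of elements of `E` of type exactly `I`, the type of `e` being
`{j | e ∈ A j}`. -/
def typeCount {α : Type*} (E : Set α) {r : ℕ} (A : Fin r → Set α) (I : Finset (Fin r)) : ℕ :=
  {e ∈ E | ∀ j, j ∈ I ↔ e ∈ A j}.ncard

/-- The simplex `Δ_{{0} ∪ I}`: the convex hull of the origin and the `e_i` with `i ∈ I`. -/
def simplexWithOrigin {r : ℕ} (I : Finset (Fin r)) : Set (Fin r → ℝ) :=
  convexHull ℝ (insert 0 ((fun i => Pi.single i (1 : ℝ)) '' (I : Set (Fin r))))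

/-- The transversalhedron: the Minkowski sum over all `I ⊆ [r]` of the dilates
`l_I • Δ_{{0} ∪ I}`. -/
def transversalhedron {α : Type*} (E : Set α) {r : ℕ} (A : Fin r → Set α) : Set (Fin r → ℝ) :=
  ∑ I : Finset (Fin r), (typeCount E A I : ℝ) • simplexWithOrigin I

/-- The monomials `x_1^{c_1 - 1} ⋯ x_r^{c_r - 1}`, given by their exponent vectors, for the
lattice points `c` of `P` that lie on no coordinate hyperplane. -/
def latticeMonomials {r : ℕ} (P : Set (Fin r → ℝ)) : Set (Fin r →₀ ℕ) :=
  {m | ∃ c : Fin r → ℤ, (fun i => (c i : ℝ)) ∈ P ∧ (∀ i, c i ≠ 0) ∧ ∀ i, (m i : ℤ) = c i - 1}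

/-- A pure monomial order ideal, monomials being given by their exponent vectors (so that
divisibility is `≤`): a finite set of monomials closed under divisors, all of whose maximal
elements have the same degree. -/
structure IsPureOrderIdeal {σ : Type*} (X : Set (σ →₀ ℕ)) : Prop where
  finite : X.Finite
  dvd_closed : ∀ m ∈ X, ∀ n, n ≤ m → n ∈ X
  pure : ∀ m n, Maximal (· ∈ X) m → Maximal (· ∈ X) n → m.degree = n.degree

/-- The number of monomials of degree `k` in `X`. -/
def degreeSequence {σ : Type*} (X : Set (σ →₀ ℕ)) (k : ℕ) : ℕ :=
  {m ∈ X | m.degree = k}.ncard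

/-- The number of `k`-element independent sets (faces of dimension `k - 1` of the
independence complex). -/
def indepCount {α : Type*} (M : Matroid α) (k : ℕ) : ℕ :=
  {I : Set α | M.Indep I ∧ I.encard = k}.ncard

open Polynomial in
/-- The `h`-polynomial `∑ h_k x^k = ∑_{i ≤ d} f_{i-1} x^i (1 - x)^{d-i}` of the independence
complex of a matroid of finite rank `d`. -/
def hPolynomial {α : Type*} (M : Matroid α) : ℤ[X] :=
  ∑ i ∈ Finset.range (M.eRank.toNat + 1),
    C (indepCount M i : ℤ) * X ^ i * (1 - X) ^ (M.eRank.toNat - i)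

/-- The entries of the `h`-vector of `M` (zero beyond the rank of `M`). -/
def hVector {α : Type*} (M : Matroid α) (k : ℕ) : ℤ :=
  (hPolynomial M).coeff k

end Cotransversal

end

/-!
Complementing the independent sets of `M` turns its `h`-polynomial into the sum of
`X ^ |E \ S| * (1 - X) ^ (|S| - r)` over the sets `S` containing a transversal of `A`. Such `S`, and
also the lattice points of the transversalhedron, are described by Hall's condition `0 ≤ φ J` for
all `J`, where `φ J = |S ∩ ⋃_{j ∈ J} A_j| - ∑_{j ∈ J} (m_j + 1)` is submodular: sets `S` vary with
`m = 0`, monomials `m` vary with `S = E`.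

Fix an index `i ∈ V` and relax Hall's condition by one unit on the sets containing `i`. By
submodularity, an object satisfying only the relaxed condition has a least violating set `U ∋ i`,
and it splits into a critical object on `U` and a Hall object on the complement of `U`. Hence the
generating functions of sets and of monomials both satisfy
`P (V \ {i}) E + (X - 1) P V E = ∑_U κ U E * X ^ (|E ∩ N(U)| + 1 - |U|) * P (V \ U) (E \ N(U))`,
where `N(U) = ⋃_{j ∈ U} A_j` and `κ U E` counts the critical objects. This recursion determines both
`κ` and `P`: evaluate at `X = 1` to find `κ V E`, then cancel `X - 1`.
-/

namespace Cotransversal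

open Finset Polynomial

section Submodular

variable {ι β R : Type*} {φ : Finset ι → ℤ} {V U K : Finset ι} {i : ι}

/-- Hall's condition on `V`, for a function `φ` measuring the excess of supply over demand. -/
def IsHall (φ : Finset ι → ℤ) (V : Finset ι) : Prop :=
  ∀ J ⊆ V, 0 ≤ φ J

/-- Hall's condition holds on the proper subsets of `U` and fails by one unit on `U` itself. -/
def IsCritical (φ : Finset ι → ℤ) (U : Finset ι) : Prop :=
  φ U = -1 ∧ ∀ J ⊂ U, 0 ≤ φ J

theorem IsCritical.neg_one_le (h : IsCritical φ U) (hK : K ⊆ U) : -1 ≤ φ K := by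
  obtain rfl | hssubset := hK.eq_or_ssubset
  · exact h.1.ge
  · linarith [h.2 K hssubset]

variable [DecidableEq ι]

/-- Submodularity of a set function. -/
def IsSubmodular (φ : Finset ι → ℤ) : Prop :=
  ∀ J K, φ (J ∪ K) + φ (J ∩ K) ≤ φ J + φ K

/-- Hall's condition on `V`, relaxed by one unit for the sets containing `i`. -/
def IsRelaxedHall (φ : Finset ι → ℤ) (V : Finset ι) (i : ι) : Prop :=
  ∀ J ⊆ V, (if i ∈ J then -1 else 0) ≤ φ J

/-- `U` is critical and minimizes `φ` among the sets between `U` and `U ∪ V`. When `φ` is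
submodular, such a `U ⊆ V` is the least subset of `V` violating Hall's condition. -/
def IsLeastViolator (φ : Finset ι → ℤ) (V U : Finset ι) : Prop :=
  IsCritical φ U ∧ ∀ J ⊆ V \ U, φ U ≤ φ (J ∪ U)

instance : Decidable (IsHall φ V) :=
  inferInstanceAs (Decidable (∀ J ⊆ V, _))

instance : Decidable (IsRelaxedHall φ V i) :=
  inferInstanceAs (Decidable (∀ J ⊆ V, _))

instance : Decidable (IsCritical φ U) :=
  @instDecidableAnd _ _ _ decidableForallOfDecidableSSubsets

instance : Decidable (IsLeastViolator φ V U) :=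
  inferInstanceAs (Decidable (_ ∧ ∀ J ⊆ V \ U, _))

theorem IsSubmodular.union_eq_zero (hφ : IsSubmodular φ) (hV : IsHall φ V) (hK : K ⊆ V)
    (hU : U ⊆ V) (hφK : φ K = 0) (hφU : φ U = 0) : φ (K ∪ U) = 0 := by
  have hunion := hV _ (union_subset hK hU)
  have hinter := hV (K ∩ U) (inter_subset_left.trans hK)
  linarith [hφ K U]

theorem IsLeastViolator.inter_le (hU : IsLeastViolator φ V U) (hφ : IsSubmodular φ)
    (hK : K ⊆ V) : φ (K ∩ U) ≤ φ K := by
  have hmin := hU.2 (K \ U) (sdiff_subset_sdiff hK subset_rfl)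
  rw [sdiff_union_self_eq_union] at hmin
  linarith [hφ K U]

theorem IsLeastViolator.subset (hU : IsLeastViolator φ V U) (hφ : IsSubmodular φ) (hK : K ⊆ V)
    (hneg : φ K < 0) : U ⊆ K := by
  by_contra hUK
  have hlt : K ∩ U ⊂ U := ⟨inter_subset_right, fun h => hUK (h.trans inter_subset_left)⟩
  linarith [hU.1.2 _ hlt, hU.inter_le hφ hK]

theorem IsLeastViolator.eq (hU : IsLeastViolator φ V U) (hφ : IsSubmodular φ)
    (hK : IsLeastViolator φ V K) (hUV : U ⊆ V) (hKV : K ⊆ V) : U = K :=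
  (hU.subset hφ hKV (by simp [hK.1.1])).antisymm (hK.subset hφ hUV (by simp [hU.1.1]))

theorem IsLeastViolator.neg_one_le (hU : IsLeastViolator φ V U) (hφ : IsSubmodular φ)
    (hK : K ⊆ V) : -1 ≤ φ K := by
  rcases le_or_gt 0 (φ K) with hnonneg | hneg
  · linarith
  · simpa [inter_eq_right.2 (hU.subset hφ hK hneg), hU.1.1] using hU.inter_le hφ hK

theorem IsLeastViolator.isRelaxedHall (hU : IsLeastViolator φ V U) (hφ : IsSubmodular φ)
    (hi : i ∈ U) : IsRelaxedHall φ V i := by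
  intro K hK
  split_ifs with hiK
  · exact hU.neg_one_le hφ hK
  · by_contra! hneg
    exact hiK (hU.subset hφ hK hneg hi)

theorem IsHall.isRelaxedHall (hV : IsHall φ V) : IsRelaxedHall φ V i := by
  intro J hJ
  split_ifs <;> linarith [hV J hJ]

theorem IsHall.not_isLeastViolator (hV : IsHall φ V) (hUV : U ⊆ V) : ¬ IsLeastViolator φ V U :=
  fun hU => by linarith [hV U hUV, hU.1.1]

theorem IsRelaxedHall.neg_one_le (h : IsRelaxedHall φ V i) (hK : K ⊆ V) : -1 ≤ φ K := by
  have := h K hK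
  split_ifs at this <;> linarith

theorem IsRelaxedHall.exists_isLeastViolator (h : IsRelaxedHall φ V i) (hV : ¬ IsHall φ V) :
    ∃ U ⊆ V, i ∈ U ∧ IsLeastViolator φ V U := by
  obtain ⟨J, hJV, hJ⟩ : ∃ J ⊆ V, φ J < 0 := by simpa [IsHall] using hV
  obtain ⟨U, hU⟩ := {K ∈ V.powerset | φ K < 0}.exists_minimal ⟨J, by simp [hJV, hJ]⟩
  obtain ⟨hUV, hneg⟩ : U ⊆ V ∧ φ U < 0 := by simpa using hU.prop
  have hφU : φ U = -1 := by linarith [h.neg_one_le hUV]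
  have hi : i ∈ U := by
    by_contra hi
    have := h U hUV
    rw [if_neg hi] at this
    linarith
  refine ⟨U, hUV, hi, ⟨hφU, fun K hK => ?_⟩, fun K hK => ?_⟩
  · by_contra! hK_neg
    exact hK.2 (hU.le_of_le (by simp [hK.1.trans hUV, hK_neg]) hK.1)
  · rw [hφU]
    exact h.neg_one_le (union_subset (hK.trans sdiff_subset) hUV)

theorem sum_isRelaxedHall [AddCommMonoid R] {φ : β → Finset ι → ℤ}
    (hφ : ∀ s, IsSubmodular (φ s)) (T : Finset β) (V : Finset ι) (i : ι) (w : β → R) :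
    ∑ s ∈ T with IsRelaxedHall (φ s) V i, w s =
      ∑ s ∈ T with IsHall (φ s) V, w s +
        ∑ U ∈ V.powerset with i ∈ U, ∑ s ∈ T with IsLeastViolator (φ s) V U, w s := by
  simp_rw [sum_filter (s := T)]
  rw [sum_comm, ← sum_add_distrib]
  refine sum_congr rfl fun s _ => ?_
  have hmem {U} : U ∈ {U ∈ V.powerset | i ∈ U} ↔ U ⊆ V ∧ i ∈ U := by simp
  by_cases hV : IsHall (φ s) V
  · rw [if_pos hV, if_pos hV.isRelaxedHall, sum_eq_zero, add_zero]
    exact fun U hU => if_neg (hV.not_isLeastViolator (hmem.1 hU).1)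
  rw [if_neg hV, zero_add]
  by_cases h : IsRelaxedHall (φ s) V i
  · obtain ⟨U, hUV, hi, hU⟩ := h.exists_isLeastViolator hV
    rw [if_pos h, sum_eq_single_of_mem U (hmem.2 ⟨hUV, hi⟩), if_pos hU]
    exact fun K hK hne => if_neg fun hK' => hne (hK'.eq (hφ s) hU (hmem.1 hK).1 hUV)
  · rw [if_neg h, sum_eq_zero]
    exact fun U hU => if_neg fun hU' => h (hU'.isRelaxedHall (hφ s) (hmem.1 hU).2)

end Submodular

section Excess

variable {ι α : Type*} [DecidableEq α] (A : ι → Finset α)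

/-- The excess, in Hall's condition, of the supply `|S ∩ ⋃_{j ∈ J} A_j|` over the demand of `J`,
where `j` demands `m_j + 1` elements. The shift makes `m = 0` the case of transversals, and turns
positive demand vectors into exponent vectors of monomials. -/
def excess (S : Finset α) (m : ι → ℕ) (J : Finset ι) : ℤ :=
  (#(S ∩ J.biUnion A) : ℤ) - (∑ j ∈ J, (m j + 1) : ℕ)

variable {A} {S E : Finset α} {m m' : ι → ℕ} {V U J : Finset ι} {i : ι}

theorem excess_nonneg_iff : 0 ≤ excess A S m J ↔ ∑ j ∈ J, (m j + 1) ≤ #(S ∩ J.biUnion A) := by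
  rw [excess, sub_nonneg, Nat.cast_le]

@[simp]
theorem excess_empty : excess A S m ∅ = 0 := by
  simp [excess]

theorem excess_congr (h : ∀ j ∈ J, m j = m' j) : excess A S m J = excess A S m' J := by
  rw [excess, excess, sum_congr rfl fun j hj => by rw [h j hj]]

theorem excess_inter_biUnion (hJ : J ⊆ U) :
    excess A (S ∩ U.biUnion A) m J = excess A S m J := by
  rw [excess, inter_assoc, inter_eq_right.2 (biUnion_subset_biUnion_of_subset_left A hJ), excess]

variable [DecidableEq ι]

theorem isSubmodular_excess (S : Finset α) (m : ι → ℕ) : IsSubmodular (excess A S m) := by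
  intro J K
  have hinter : (J ∩ K).biUnion A ⊆ J.biUnion A ∩ K.biUnion A :=
    subset_inter (biUnion_subset_biUnion_of_subset_left A inter_subset_left)
      (biUnion_subset_biUnion_of_subset_left A inter_subset_right)
  have hsupply := card_union_add_card_inter (S ∩ J.biUnion A) (S ∩ K.biUnion A)
  rw [← inter_union_distrib_left, ← union_biUnion, ← inter_inter_distrib_left] at hsupply
  have hle := card_le_card (inter_subset_inter_left hinter : S ∩ _ ⊆ S ∩ _)
  have hdemand := sum_union_inter (s₁ := J) (s₂ := K) (f := fun j => m j + 1)
  simp only [excess]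
  lia

theorem excess_union (h : Disjoint J U) :
    excess A S m (J ∪ U) = excess A (S \ U.biUnion A) m J + excess A S m U := by
  have hsupply : S ∩ (J ∪ U).biUnion A = (S \ U.biUnion A) ∩ J.biUnion A ∪ S ∩ U.biUnion A := by
    rw [union_biUnion]
    grind
  have hdisj : Disjoint ((S \ U.biUnion A) ∩ J.biUnion A) (S ∩ U.biUnion A) :=
    (disjoint_sdiff_self_left.mono inter_subset_left inter_subset_right)
  rw [excess, hsupply, card_union_of_disjoint hdisj, sum_union h, excess, excess]
  push_cast
  ring

theorem isLeastViolator_excess_iff :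
    IsLeastViolator (excess A S m) V U ↔
      IsCritical (excess A S m) U ∧ IsHall (excess A (S \ U.biUnion A) m) (V \ U) := by
  refine and_congr_right fun _ => forall₂_congr fun J hJ => ?_
  rw [excess_union (disjoint_of_subset_left hJ sdiff_disjoint), le_add_iff_nonneg_left]

theorem isRelaxedHall_excess_iff_erase (hm : m i = 0) :
    IsRelaxedHall (excess A S m) V i ↔ IsHall (excess A S m) (V.erase i) := by
  refine ⟨fun h J hJ => ?_, fun h J hJ => ?_⟩
  · obtain ⟨hJV, hi⟩ := subset_erase.1 hJ
    simpa [hi] using h J hJV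
  · split_ifs with hi
    · have herase := h (J.erase i) (erase_subset_erase i hJ)
      have hdemand := add_sum_erase J (fun j => m j + 1) hi
      have hsupply := card_le_card (inter_subset_inter_left
        (biUnion_subset_biUnion_of_subset_left A (erase_subset i J)) : S ∩ _ ⊆ S ∩ _)
      simp only [excess] at herase ⊢
      lia
    · exact h J (subset_erase.2 ⟨hJ, hi⟩)

theorem excess_add_single :
    excess A S (m + Pi.single i 1) J = excess A S m J + if i ∈ J then -1 else 0 := by
  have hdemand : ∑ j ∈ J, ((m + Pi.single i 1 : ι → ℕ) j + 1) =
      ∑ j ∈ J, (m j + 1) + if i ∈ J then 1 else 0 := by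
    simp_rw [Pi.add_apply, Pi.single_apply, add_right_comm _ _ 1]
    rw [sum_add_distrib, sum_ite_eq']
  rw [excess, hdemand, excess]
  split_ifs <;> lia

theorem isRelaxedHall_excess_add_single :
    IsRelaxedHall (excess A S (m + Pi.single i 1)) V i ↔ IsHall (excess A S m) V :=
  forall₂_congr fun J _ => by rw [excess_add_single, le_add_iff_nonneg_left]

end Excess

section Recursion

variable {ι α : Type*} [DecidableEq ι] [DecidableEq α] {A : ι → Finset α}

/-- The recursion shared by the generating functions `P V E` of the objects satisfying Hall's
condition for the subfamily `V` on the ground set `E`, where `κ U E` is the number of critical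
objects. -/
structure IsHallRecursion (A : ι → Finset α) (κ : Finset ι → Finset α → ℕ)
    (P : Finset ι → Finset α → ℤ[X]) : Prop where
  empty : ∀ E, P ∅ E = 1
  step : ∀ V, ∀ i ∈ V, ∀ E, P (V.erase i) E + (X - 1) * P V E =
    ∑ U ∈ V.powerset with i ∈ U,
      (κ U E : ℤ[X]) * X ^ (#(E ∩ U.biUnion A) + 1 - #U) * P (V \ U) (E \ U.biUnion A)

/-- The term `U = V` is the only one in which `κ V` occurs. Evaluating at `X = 1` determines it,
and cancelling `X - 1` then determines `P V`. -/
theorem IsHallRecursion.eq_and_eq {κ κ' : Finset ι → Finset α → ℕ}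
    {P P' : Finset ι → Finset α → ℤ[X]} (h : IsHallRecursion A κ P)
    (h' : IsHallRecursion A κ' P') (V : Finset ι) :
    (V.Nonempty → ∀ E, κ V E = κ' V E) ∧ ∀ E, P V E = P' V E := by
  induction V using Finset.strongInduction with
  | H V ih =>
  obtain rfl | ⟨i, hi⟩ := V.eq_empty_or_nonempty
  · simp [h.empty, h'.empty]
  have hκ_sub_mul (E) : (X - 1) * (P V E - P' V E) =
      ((κ V E : ℤ[X]) - (κ' V E : ℤ[X])) * X ^ (#(E ∩ V.biUnion A) + 1 - #V) := by
    have hsmaller : ∀ U ∈ {U ∈ V.powerset | i ∈ U}.erase V,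
        (κ U E : ℤ[X]) * X ^ (#(E ∩ U.biUnion A) + 1 - #U) * P (V \ U) (E \ U.biUnion A) =
          (κ' U E : ℤ[X]) * X ^ (#(E ∩ U.biUnion A) + 1 - #U) *
            P' (V \ U) (E \ U.biUnion A) := by
      intro U hU
      obtain ⟨hne, hUV, hiU⟩ : U ≠ V ∧ U ⊆ V ∧ i ∈ U := by simpa using hU
      rw [(ih U (hUV.ssubset_of_ne hne)).1 ⟨i, hiU⟩, (ih _ (sdiff_ssubset hUV ⟨i, hiU⟩)).2]
    have hV : V ∈ {U ∈ V.powerset | i ∈ U} := by simp [hi]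
    have hP := h.step V i hi E
    have hP' := h'.step V i hi E
    rw [← add_sum_erase _ _ hV, sdiff_self, bot_eq_empty, h.empty, sum_congr rfl hsmaller,
      (ih _ (erase_ssubset hi)).2] at hP
    rw [← add_sum_erase _ _ hV, sdiff_self, bot_eq_empty, h'.empty] at hP'
    linear_combination hP - hP'
  have hκ (E) : κ V E = κ' V E := by
    have heval := congrArg (eval 1) (hκ_sub_mul E)
    simp only [eval_mul, eval_sub, eval_X, eval_one, eval_natCast, eval_pow, one_pow] at heval
    lia
  refine ⟨fun _ => hκ, fun E => sub_eq_zero.1 ?_⟩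
  have hcancel := hκ_sub_mul E
  rw [hκ, sub_self, zero_mul] at hcancel
  exact (mul_eq_zero.1 hcancel).resolve_left (X_sub_C_ne_zero (1 : ℤ))

theorem IsHallRecursion.unique {κ κ' : Finset ι → Finset α → ℕ}
    {P P' : Finset ι → Finset α → ℤ[X]} (h : IsHallRecursion A κ P)
    (h' : IsHallRecursion A κ' P') : P = P' :=
  funext₂ fun V => (h.eq_and_eq h' V).2

end Recursion

section Sets

variable {ι α : Type*} [DecidableEq α] (A : ι → Finset α)

/-- The subsets of `E` satisfying Hall's condition for the subfamily `V`, that is, containing a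
transversal of it. -/
def hallSets (V : Finset ι) (E : Finset α) : Finset (Finset α) :=
  {S ∈ E.powerset | IsHall (excess A S 0) V}

/-- The subsets of `E ∩ ⋃_{j ∈ U} A_j` that contain transversals of all proper subfamilies of
`U`, but are one element short of a transversal of `U`. -/
def criticalSets [DecidableEq ι] (U : Finset ι) (E : Finset α) : Finset (Finset α) :=
  {S ∈ (E ∩ U.biUnion A).powerset | IsCritical (excess A S 0) U}

/-- The generating function of `hallSets`. For the family presenting the dual of a matroid this
is the `h`-polynomial, rewritten in terms of complements of independent sets. -/
noncomputable def setPolynomial (V : Finset ι) (E : Finset α) : ℤ[X] :=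
  ∑ S ∈ hallSets A V E, X ^ #(E \ S) * (1 - X) ^ (#S - #V)

variable {A} {V U : Finset ι} {E S : Finset α} {i : ι}

theorem mem_hallSets : S ∈ hallSets A V E ↔ S ⊆ E ∧ IsHall (excess A S 0) V := by
  simp [hallSets]

theorem card_le_card_of_isHall_excess_zero (h : IsHall (excess A S 0) V) : #V ≤ #S := by
  have hV := excess_nonneg_iff.1 (h V subset_rfl)
  simp only [Pi.zero_apply, zero_add, sum_const, smul_eq_mul, mul_one] at hV
  exact hV.trans (card_le_card inter_subset_left)

theorem one_sub_X_mul_setPolynomial (V : Finset ι) (E : Finset α) :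
    (1 - X) * setPolynomial A V E =
      ∑ S ∈ E.powerset with IsHall (excess A S 0) V, X ^ #(E \ S) * (1 - X) ^ (#S + 1 - #V) := by
  rw [setPolynomial, mul_sum]
  refine sum_congr rfl fun S hS => ?_
  rw [Nat.sub_add_comm (card_le_card_of_isHall_excess_zero (mem_hallSets.1 hS).2), pow_succ]
  ring

theorem setPolynomial_empty (E : Finset α) : setPolynomial A ∅ E = 1 := by
  have hall : hallSets A ∅ E = E.powerset := by
    ext S
    simp [mem_hallSets, IsHall, subset_empty]
  calc setPolynomial A ∅ E = ∑ S ∈ E.powerset, (1 - X) ^ #S * X ^ (#E - #S) := by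
        rw [setPolynomial, hall]
        refine sum_congr rfl fun S hS => ?_
        rw [card_sdiff_of_subset (mem_powerset.1 hS), card_empty, Nat.sub_zero, mul_comm]
    _ = (1 - X + X) ^ #E := sum_pow_mul_eq_add_pow (1 - X) X E
    _ = 1 := by rw [sub_add_cancel, one_pow]

variable [DecidableEq ι]

theorem mem_criticalSets :
    S ∈ criticalSets A U E ↔ S ⊆ E ∩ U.biUnion A ∧ IsCritical (excess A S 0) U := by
  rw [criticalSets, mem_filter, mem_powerset]

theorem card_add_one_of_mem_criticalSets (h : S ∈ criticalSets A U E) : #S + 1 = #U := by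
  obtain ⟨hS, hcrit, -⟩ := mem_criticalSets.1 h
  rw [excess, inter_eq_left.2 (hS.trans inter_subset_right)] at hcrit
  simp only [Pi.zero_apply, zero_add, sum_const, smul_eq_mul, mul_one] at hcrit
  lia

theorem subset_and_isLeastViolator_iff :
    S ⊆ E ∧ IsLeastViolator (excess A S 0) V U ↔
      S ∩ U.biUnion A ∈ criticalSets A U E ∧
        S \ U.biUnion A ∈ hallSets A (V \ U) (E \ U.biUnion A) := by
  have hsub : S ⊆ E ↔ S ∩ U.biUnion A ⊆ E ∩ U.biUnion A ∧ S \ U.biUnion A ⊆ E \ U.biUnion A := by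
    refine ⟨fun h => ⟨inter_subset_inter_right h, sdiff_subset_sdiff h subset_rfl⟩, fun h => ?_⟩
    rw [← sdiff_union_inter S (U.biUnion A)]
    exact union_subset (h.2.trans sdiff_subset) (h.1.trans inter_subset_left)
  have hcrit : IsCritical (excess A (S ∩ U.biUnion A) 0) U ↔ IsCritical (excess A S 0) U := by
    refine and_congr (by rw [excess_inter_biUnion subset_rfl]) (forall₂_congr fun J hJ => ?_)
    rw [excess_inter_biUnion hJ.subset]
  rw [mem_criticalSets, mem_hallSets, hcrit, isLeastViolator_excess_iff, hsub]
  tauto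

theorem sum_sets_isLeastViolator (hU : U ⊆ V) (E : Finset α) :
    ∑ S ∈ E.powerset with IsLeastViolator (excess A S 0) V U,
        (X ^ #(E \ S) * (1 - X) ^ (#S + 1 - #V) : ℤ[X]) =
      (#(criticalSets A U E) : ℤ[X]) * X ^ (#(E ∩ U.biUnion A) + 1 - #U) *
        setPolynomial A (V \ U) (E \ U.biUnion A) := by
  rw [setPolynomial, mul_assoc, mul_sum, ← nsmul_eq_mul, ← sum_const, ← sum_product']
  have hmem {S} : S ∈ {S ∈ E.powerset | IsLeastViolator (excess A S 0) V U} ↔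
      (S ∩ U.biUnion A, S \ U.biUnion A) ∈
        criticalSets A U E ×ˢ hallSets A (V \ U) (E \ U.biUnion A) := by
    rw [mem_filter, mem_powerset, subset_and_isLeastViolator_iff, mem_product]
  have hsplit : ∀ p ∈ criticalSets A U E ×ˢ hallSets A (V \ U) (E \ U.biUnion A),
      ((p.1 ∪ p.2) ∩ U.biUnion A, (p.1 ∪ p.2) \ U.biUnion A) = p := by
    intro p hp
    have hp₁ := (mem_criticalSets.1 (mem_product.1 hp).1).1
    have hp₂ := (mem_hallSets.1 (mem_product.1 hp).2).1
    ext <;> grind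
  refine sum_nbij' (fun S => (S ∩ U.biUnion A, S \ U.biUnion A)) (fun p => p.1 ∪ p.2)
    (fun S => hmem.1) (fun p hp => hmem.2 ((hsplit p hp).symm ▸ hp))
    (fun S _ => sup_inf_sdiff S _) hsplit fun S hS => ?_
  obtain ⟨hcrit, hhall⟩ := mem_product.1 (hmem.1 hS)
  have hSE : S ⊆ E := mem_powerset.1 (mem_filter.1 hS).1
  have hcard_crit := card_add_one_of_mem_criticalSets hcrit
  have hcard_hall := card_le_card_of_isHall_excess_zero (mem_hallSets.1 hhall).2
  have hcard_sub := card_le_card (mem_hallSets.1 hhall).1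
  have hcard_inter := card_le_card (inter_subset_inter_right hSE : S ∩ U.biUnion A ⊆ _)
  have hcard_S := card_inter_add_card_sdiff S (U.biUnion A)
  have hcard_E := card_inter_add_card_sdiff E (U.biUnion A)
  have hcard_V := card_sdiff_add_card_eq_card hU
  rw [← mul_assoc, ← pow_add, card_sdiff_of_subset hSE,
    card_sdiff_of_subset (mem_hallSets.1 hhall).1]
  congr 2 <;> lia

theorem setPolynomial_erase (hi : i ∈ V) (E : Finset α) :
    setPolynomial A (V.erase i) E =
      ∑ S ∈ E.powerset with IsRelaxedHall (excess A S 0) V i,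
        X ^ #(E \ S) * (1 - X) ^ (#S + 1 - #V) := by
  simp only [setPolynomial, hallSets, isRelaxedHall_excess_iff_erase (m := 0) (i := i) rfl]
  have hV : 0 < #V := card_pos.2 ⟨i, hi⟩
  rw [card_erase_of_mem hi]
  refine sum_congr rfl fun S _ => ?_
  congr 2
  lia

theorem isHallRecursion_setPolynomial (A : ι → Finset α) :
    IsHallRecursion A (fun U E => #(criticalSets A U E)) (setPolynomial A) where
  empty := setPolynomial_empty
  step V i hi E := by
    have hsum := sum_isRelaxedHall (fun S => isSubmodular_excess (A := A) S 0) E.powerset V i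
      fun S => (X ^ #(E \ S) * (1 - X) ^ (#S + 1 - #V) : ℤ[X])
    rw [← setPolynomial_erase hi, ← one_sub_X_mul_setPolynomial,
      sum_congr rfl fun U hU => sum_sets_isLeastViolator (mem_powerset.1 (mem_filter.1 hU).1) E]
      at hsum
    linear_combination hsum

end Sets

section Monomials

variable {ι α : Type*} [DecidableEq α] (A : ι → Finset α)

/-- The monomials in the variables `V` whose exponents `m_j` are at most `|E ∩ A_j|`. This finite
set contains all monomials relevant to the recursion. -/
noncomputable def box (V : Finset ι) (E : Finset α) : Finset (ι →₀ ℕ) :=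
  V.finsupp fun j => range (#(E ∩ A j) + 1)

/-- The monomials in the variables `V`, given by their exponent vectors `m`, for which `E`
satisfies Hall's condition with demands `m_j + 1`. -/
noncomputable def hallMonomials (V : Finset ι) (E : Finset α) : Finset (ι →₀ ℕ) :=
  {m ∈ box A V E | IsHall (excess A E m) V}

/-- The monomials in the variables `U` for which `E` satisfies Hall's condition with demands
`m_j + 1` on all proper subfamilies of `U`, but is one element short on `U`. -/
noncomputable def criticalMonomials [DecidableEq ι] (U : Finset ι) (E : Finset α) :
    Finset (ι →₀ ℕ) :=
  {m ∈ box A U E | IsCritical (excess A E m) U}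

/-- The generating function of `hallMonomials` by degree. -/
noncomputable def monomialPolynomial (V : Finset ι) (E : Finset α) : ℤ[X] :=
  ∑ m ∈ hallMonomials A V E, X ^ m.degree

variable {A} {V U : Finset ι} {E : Finset α} {m : ι →₀ ℕ} {i : ι}

theorem mem_filter_box_iff {p : (ι →₀ ℕ) → Prop} [DecidablePred p]
    (hp : ∀ m, p m → ∀ J ⊆ V, -1 ≤ excess A E m J) :
    m ∈ {m ∈ box A V E | p m} ↔ m.support ⊆ V ∧ p m := by
  rw [mem_filter]
  refine and_congr_left fun h => mem_finsupp_iff.trans (and_iff_left fun j hj => ?_)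
  have hsingleton := hp m h {j} (singleton_subset_iff.2 hj)
  rw [excess, singleton_biUnion, sum_singleton] at hsingleton
  rw [mem_range]
  lia

theorem mem_hallMonomials :
    m ∈ hallMonomials A V E ↔ m.support ⊆ V ∧ IsHall (excess A E m) V :=
  mem_filter_box_iff fun _ h J hJ => by linarith [h J hJ]

theorem excess_eq_card_sub_degree (hm : m.support ⊆ V) :
    excess A E m V = #(E ∩ V.biUnion A) - (m.degree + #V : ℕ) := by
  rw [excess, sum_add_distrib, ← card_eq_sum_ones, Finsupp.degree_apply,
    sum_subset hm fun j _ hj => Finsupp.notMem_support_iff.1 hj]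

theorem monomialPolynomial_empty (E : Finset α) : monomialPolynomial A ∅ E = 1 := by
  have hall : hallMonomials A ∅ E = {0} := by
    ext m
    simp +contextual [mem_hallMonomials, IsHall, subset_empty]
  rw [monomialPolynomial, hall, sum_singleton, map_zero, pow_zero]

variable [DecidableEq ι]

theorem mem_criticalMonomials :
    m ∈ criticalMonomials A U E ↔ m.support ⊆ U ∧ IsCritical (excess A E m) U :=
  mem_filter_box_iff fun _ h _ => h.neg_one_le

theorem degree_of_mem_criticalMonomials (hm : m ∈ criticalMonomials A U E) :
    m.degree = #(E ∩ U.biUnion A) + 1 - #U := by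
  obtain ⟨hsupport, hcrit, -⟩ := mem_criticalMonomials.1 hm
  rw [excess_eq_card_sub_degree hsupport] at hcrit
  lia

theorem mem_filter_isLeastViolator_iff (hU : U ⊆ V) :
    m ∈ {m ∈ box A V E | IsLeastViolator (excess A E (m : ι →₀ ℕ)) V U} ↔
      m.filter (· ∈ U) ∈ criticalMonomials A U E ∧
        m.filter (· ∉ U) ∈ hallMonomials A (V \ U) (E \ U.biUnion A) := by
  rw [mem_filter_box_iff fun m h _ => h.neg_one_le (isSubmodular_excess E m)]
  have hsupport : m.support ⊆ V ↔ (m.filter (· ∉ U)).support ⊆ V \ U := by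
    simp only [Finsupp.support_filter, subset_iff, mem_filter, mem_sdiff]
    grind
  have hsupport_filter : (m.filter (· ∈ U)).support ⊆ U := by
    simp [Finsupp.support_filter, subset_iff]
  have hcrit : IsCritical (excess A E (m.filter (· ∈ U))) U ↔ IsCritical (excess A E m) U := by
    have hexcess {J} (hJ : J ⊆ U) : excess A E (m.filter (· ∈ U)) J = excess A E m J :=
      excess_congr fun j hj => Finsupp.filter_apply_pos _ _ (hJ hj)
    exact and_congr (by rw [hexcess subset_rfl])
      (forall₂_congr fun J hJ => by rw [hexcess hJ.subset])
  have hhall : IsHall (excess A (E \ U.biUnion A) (m.filter (· ∉ U))) (V \ U) ↔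
      IsHall (excess A (E \ U.biUnion A) m) (V \ U) :=
    forall₂_congr fun J hJ => by
      rw [excess_congr fun j hj => Finsupp.filter_apply_pos (· ∉ U) m (mem_sdiff.1 (hJ hj)).2]
  rw [mem_criticalMonomials, mem_hallMonomials, hcrit, hhall, ← hsupport,
    isLeastViolator_excess_iff]
  tauto

theorem sum_monomials_isLeastViolator (hU : U ⊆ V) (E : Finset α) :
    ∑ m ∈ box A V E with IsLeastViolator (excess A E (m : ι →₀ ℕ)) V U, (X ^ m.degree : ℤ[X]) =
      (#(criticalMonomials A U E) : ℤ[X]) * X ^ (#(E ∩ U.biUnion A) + 1 - #U) *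
        monomialPolynomial A (V \ U) (E \ U.biUnion A) := by
  rw [monomialPolynomial, mul_assoc, mul_sum, ← nsmul_eq_mul, ← sum_const, ← sum_product']
  have hsplit : ∀ p ∈ criticalMonomials A U E ×ˢ hallMonomials A (V \ U) (E \ U.biUnion A),
      ((p.1 + p.2).filter (· ∈ U), (p.1 + p.2).filter (· ∉ U)) = p := by
    intro p hp
    have hp₁ {j} (hj : j ∉ U) : p.1 j = 0 := Finsupp.notMem_support_iff.1 fun h =>
      hj ((mem_criticalMonomials.1 (mem_product.1 hp).1).1 h)
    have hp₂ {j} (hj : j ∈ U) : p.2 j = 0 := Finsupp.notMem_support_iff.1 fun h =>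
      (mem_sdiff.1 ((mem_hallMonomials.1 (mem_product.1 hp).2).1 h)).2 hj
    refine Prod.ext (Finsupp.ext fun j => ?_) (Finsupp.ext fun j => ?_) <;>
      by_cases hj : j ∈ U <;> simp [hj, hp₁, hp₂]
  refine sum_nbij' (fun m => (m.filter (· ∈ U), m.filter (· ∉ U))) (fun p => p.1 + p.2)
    (fun m hm => mem_product.2 ((mem_filter_isLeastViolator_iff hU).1 hm))
    (fun p hp => (mem_filter_isLeastViolator_iff hU).2
      (mem_product.1 ((hsplit p hp).symm ▸ hp)))
    (fun m _ => Finsupp.filter_add_filter_not m _) hsplit fun m hm => ?_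
  dsimp only
  rw [← degree_of_mem_criticalMonomials ((mem_filter_isLeastViolator_iff hU).1 hm).1, ← pow_add,
    ← map_add, Finsupp.filter_add_filter_not]

theorem sum_monomials_isRelaxedHall (hi : i ∈ V) (E : Finset α) :
    ∑ m ∈ box A V E with IsRelaxedHall (excess A E (m : ι →₀ ℕ)) V i, (X ^ m.degree : ℤ[X]) =
      monomialPolynomial A (V.erase i) E + X * monomialPolynomial A V E := by
  have hmem {m} : m ∈ {m ∈ box A V E | IsRelaxedHall (excess A E (m : ι →₀ ℕ)) V i} ↔
      m.support ⊆ V ∧ IsRelaxedHall (excess A E m) V i :=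
    mem_filter_box_iff fun _ h _ => IsRelaxedHall.neg_one_le h
  rw [← sum_filter_add_sum_filter_not _ (fun m => m i = 0), monomialPolynomial,
    monomialPolynomial, mul_sum]
  congr 1
  · refine sum_congr (ext fun m => ?_) fun _ _ => rfl
    rw [mem_filter, hmem, mem_hallMonomials, subset_erase, Finsupp.notMem_support_iff, and_assoc,
      and_assoc, and_comm (b := m i = 0)]
    exact and_congr_right fun _ => and_congr_right fun hmi => isRelaxedHall_excess_iff_erase hmi
  · have hadd {m : ι →₀ ℕ} : m + Finsupp.single i 1 ∈
        {m ∈ {m ∈ box A V E | IsRelaxedHall (excess A E (m : ι →₀ ℕ)) V i} | m i ≠ 0} ↔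
          m ∈ hallMonomials A V E := by
      rw [mem_filter, hmem, mem_hallMonomials, Finsupp.support_add_eq_union, union_subset_iff,
        Finsupp.coe_add, Finsupp.single_eq_pi_single, isRelaxedHall_excess_add_single]
      simp [Finsupp.support_single, hi]
    have hsub : ∀ m ∈
        {m ∈ {m ∈ box A V E | IsRelaxedHall (excess A E (m : ι →₀ ℕ)) V i} | m i ≠ 0},
        m - Finsupp.single i 1 + Finsupp.single i 1 = m := fun m hm =>
      tsub_add_cancel_of_le
        (Finsupp.single_le_iff.2 (Nat.one_le_iff_ne_zero.2 (mem_filter.1 hm).2))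
    refine (sum_nbij' (· + Finsupp.single i 1) (· - Finsupp.single i 1) (fun m => hadd.2)
      (fun m hm => hadd.1 ((hsub m hm).symm ▸ hm)) (fun m _ => add_tsub_cancel_right m _) hsub
      fun m _ => ?_).symm
    rw [map_add, Finsupp.degree_single, pow_succ']

theorem isHallRecursion_monomialPolynomial (A : ι → Finset α) :
    IsHallRecursion A (fun U E => #(criticalMonomials A U E)) (monomialPolynomial A) where
  empty := monomialPolynomial_empty
  step V i hi E := by
    have hsum := sum_isRelaxedHall (fun m : ι →₀ ℕ => isSubmodular_excess (A := A) E m) (box A V E)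
      V i fun m => (X ^ m.degree : ℤ[X])
    rw [sum_monomials_isRelaxedHall hi,
      sum_congr rfl fun U hU =>
        sum_monomials_isLeastViolator (mem_powerset.1 (mem_filter.1 hU).1) E] at hsum
    change monomialPolynomial A (V.erase i) E + X * monomialPolynomial A V E =
      monomialPolynomial A V E + _ at hsum
    linear_combination hsum

end Monomials

theorem setPolynomial_eq_monomialPolynomial {ι α : Type*} [DecidableEq α] (A : ι → Finset α) :
    setPolynomial A = monomialPolynomial A := by
  classical
  exact (isHallRecursion_setPolynomial A).unique (isHallRecursion_monomialPolynomial A)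

section Presentation

variable {α : Type*}

theorem exists_transversal_iff_isHall {ι : Type*} [Fintype ι] [DecidableEq α]
    (A : ι → Finset α) (S : Finset α) :
    (∃ g : ι → α, g.Injective ∧ ∀ j, g j ∈ S ∧ g j ∈ A j) ↔ IsHall (excess A S 0) univ := by
  simp_rw [← mem_inter]
  rw [← all_card_le_biUnion_card_iff_exists_injective]
  refine forall_congr' fun J => ?_
  rw [excess_nonneg_iff, inter_biUnion]
  simp

variable {N : Matroid α} {m r : ℕ} {A : Fin m → Set α}

theorem IsPresentation.indep_range (hA : IsPresentation N A) {κ : Type*} {g : κ → α}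
    {f : κ → Fin m} (hf : f.Injective) (hgf : ∀ k, g k ∈ A (f k)) : N.Indep (Set.range g) := by
  rw [hA.2]
  choose k hk using fun e : Set.range g => e.2
  exact ⟨f ∘ k, hf.comp (Function.Injective.of_comp (f := g) (by
    simpa only [Function.comp_def, hk] using Subtype.val_injective)), fun e => hk e ▸ hgf (k e)⟩

theorem IsPresentation.spanning_iff_exists_transversal (hA : IsPresentation N A)
    (hr : N.eRank = m) {S : Set α} (hS : S ⊆ N.E) :
    N.Spanning S ↔ ∃ g : Fin m → α, g.Injective ∧ ∀ j, g j ∈ S ∧ g j ∈ A j := by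
  refine ⟨fun h => ?_, fun ⟨g, hg, hgA⟩ => ?_⟩
  · obtain ⟨B, hB, hBS⟩ := h.exists_isBase_subset
    obtain ⟨f, hf, hfA⟩ := (hA.2 B).1 hB.indep
    have hcard : B.encard = m := hB.encard_eq_eRank.trans hr
    have : Finite B := Set.finite_of_encard_eq_coe hcard
    have hf_surj : f.Surjective := (hf.bijective_of_nat_card_le (by
      rw [Nat.card_fin, Nat.card_coe_set_eq, Set.ncard, hcard, ENat.toNat_natCast])).2
    choose g hg using hf_surj
    exact ⟨fun j => g j, Subtype.val_injective.comp (Function.LeftInverse.injective hg),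
      fun j => ⟨hBS (g j).2, by simpa only [hg] using hfA (g j)⟩⟩
  · have hI : N.Indep (Set.range g) :=
      hA.indep_range Function.injective_id fun j => (hgA j).2
    have hB : N.IsBase (Set.range g) := hI.isBase_of_eRk_ge (Set.finite_range g) <| by
      rw [hI.eRk_eq_encard, hr, ← Set.image_univ, hg.encard_image, Set.encard_univ,
        ENat.card_eq_coe_fintype_card, Fintype.card_fin]
    exact hB.spanning_of_superset (Set.range_subset_iff.2 fun j => (hgA j).1) hS

open Classical in
/-- Otherwise `I` together with the basis elements `b j` whose partner `A (f j)` misses `I` would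
be an independent set of more than `r` elements. -/
theorem IsPresentation.card_le_card_filter_of_indep (hA : IsPresentation N A) (hr : N.eRank = r)
    {b : Fin r → α} (hb : b.Injective) {f : Fin r → Fin m} (hf : f.Injective)
    (hbA : ∀ j, b j ∈ A (f j)) {I : Finset α} (hI : N.Indep I) :
    #I ≤ #{j | ∃ e ∈ I, e ∈ A (f j)} := by
  obtain ⟨g, hg, hgA⟩ := (hA.2 I).1 hI
  let J := {j // ¬ ∃ e ∈ I, e ∈ A (f j)}
  have hJ {e j} (he : e ∈ I) (hj : ¬ ∃ e ∈ I, e ∈ A (f j)) : e ∉ A (f j) :=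
    fun h => hj ⟨e, he, h⟩
  let vertex : I ⊕ J → α := Sum.elim (fun e => e) (fun j => b j)
  let partner : I ⊕ J → Fin m := Sum.elim (fun e => g e) (fun j => f j)
  have hvertex : vertex.Injective :=
    Subtype.val_injective.sumElim (hb.comp Subtype.val_injective) fun e j h =>
      hJ e.2 j.2 (h ▸ hbA j)
  have hpartner : partner.Injective :=
    hg.sumElim (hf.comp Subtype.val_injective) fun e j h => hJ e.2 j.2 (h ▸ hgA e)
  have hindep : N.Indep (Set.range vertex) :=
    hA.indep_range hpartner (Sum.rec hgA fun j => hbA j)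
  have hle := hindep.encard_le_eRank
  rw [hr, ← Set.image_univ, hvertex.encard_image, Set.encard_univ,
    ENat.card_eq_coe_fintype_card, Nat.cast_le, Fintype.card_sum, Fintype.card_coe,
    Fintype.card_subtype] at hle
  have hcompl := card_filter_add_card_filter_not (s := univ)
    (fun j : Fin r => ∃ e ∈ I, e ∈ A (f j))
  rw [card_univ, Fintype.card_fin] at hcompl
  lia

theorem IsPresentation.exists_of_eRank_eq (hA : IsPresentation N A) (hr : N.eRank = r) :
    ∃ A' : Fin r → Set α, IsPresentation N A' := by
  classical
  obtain ⟨B, hB⟩ := N.exists_isBase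
  obtain ⟨f, hf, hfA⟩ := (hA.2 B).1 hB.indep
  have hcard : B.encard = r := hB.encard_eq_eRank.trans hr
  have : Finite B := Set.finite_of_encard_eq_coe hcard
  let F : Fin r ≃ B := (Finite.equivFinOfCardEq (by
    rw [Nat.card_coe_set_eq, Set.ncard, hcard, ENat.toNat_natCast])).symm
  refine ⟨fun j => A (f (F j)), fun j => hA.1 _, fun I => ⟨fun hI => ?_, ?_⟩⟩
  · refine (Fintype.all_card_le_filter_rel_iff_exists_injective
      fun (e : I) j => (e : α) ∈ A (f (F j))).1 fun Z => ?_
    have hZ := hA.card_le_card_filter_of_indep hr (Subtype.val_injective.comp F.injective)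
      (hf.comp F.injective) (fun j => hfA (F j)) (I := Z.map ⟨_, Subtype.val_injective⟩)
      (hI.subset (by simp +contextual [Set.subset_def]))
    simpa [card_map] using hZ
  · rintro ⟨k, hk, hkA⟩
    exact (hA.2 I).2 ⟨fun e => f (F (k e)), hf.comp (F.injective.comp hk), hkA⟩

end Presentation

section HPolynomial

variable {α : Type*}

open Classical in
theorem indepCount_eq_card {M : Matroid α} {E : Finset α} (hE : (E : Set α) = M.E) (k : ℕ) :
    indepCount M k = #{I ∈ {I ∈ E.powerset | M.Indep (I : Finset α)} | #I = k} := by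
  rw [← Set.ncard_coe_finset, ← Set.ncard_image_of_injective _ coe_injective, indepCount]
  congr 1
  ext I
  refine ⟨fun ⟨hI, hcard⟩ => ?_, ?_⟩
  · have hIE : I ⊆ E := hE ▸ hI.subset_ground
    lift I to Finset α using E.finite_toSet.subset hIE
    exact ⟨I, by simpa using ⟨⟨hIE, hI⟩, by simpa using hcard⟩, rfl⟩
  · rintro ⟨I, hI, rfl⟩
    simp_all

open Classical in
theorem hPolynomial_eq_sum_indep {M : Matroid α} {E : Finset α} (hE : (E : Set α) = M.E) :
    hPolynomial M = ∑ I ∈ E.powerset with M.Indep (I : Finset α),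
      X ^ #I * (1 - X) ^ (M.eRank.toNat - #I) := by
  have hrank : ∀ I ∈ {I ∈ E.powerset | M.Indep (I : Finset α)},
      #I ∈ range (M.eRank.toNat + 1) := fun I hI => by
    obtain ⟨-, hI⟩ := mem_filter.1 hI
    have hfinite : M.Finite := ⟨hE ▸ E.finite_toSet⟩
    have hle := hI.encard_le_eRank
    rw [Set.encard_coe_eq_coe_finsetCard,
      ← ENat.natCast_toNat (M.eRank_ne_top_iff.2 inferInstance), Nat.cast_le] at hle
    exact mem_range_succ_iff.2 hle
  rw [hPolynomial, ← sum_fiberwise_of_maps_to hrank]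
  refine sum_congr rfl fun k _ => ?_
  rw [indepCount_eq_card hE, sum_congr rfl fun I hI => by rw [(mem_filter.1 hI).2], sum_const,
    nsmul_eq_mul, mul_assoc]
  rfl

theorem hPolynomial_eq_setPolynomial [DecidableEq α] {M : Matroid α} {r : ℕ}
    {A : Fin r → Finset α} (hA : IsPresentation M✶ fun j => (A j : Set α)) (hr : M✶.eRank = r)
    {E : Finset α} (hE : (E : Set α) = M.E) : hPolynomial M = setPolynomial A univ E := by
  classical
  have hrank : M.eRank.toNat + r = #E := by
    have hfinite : M.Finite := ⟨hE ▸ E.finite_toSet⟩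
    have hsum := M.eRank_add_eRank_dual
    rw [hr, ← hE, Set.encard_coe_eq_coe_finsetCard,
      ← ENat.natCast_toNat (M.eRank_ne_top_iff.2 inferInstance)] at hsum
    exact_mod_cast hsum
  have hmem {S} (hS : S ⊆ E) : S ∈ hallSets A univ E ↔ M.Indep (E \ S : Finset α) := by
    have hSE : (S : Set α) ⊆ M✶.E := by rwa [Matroid.dual_ground, ← hE, coe_subset]
    rw [mem_hallSets, and_iff_right hS, ← exists_transversal_iff_isHall, coe_sdiff, hE,
      ← Matroid.dual_coindep_iff, ← Matroid.dual_ground, ← Matroid.spanning_iff_compl_coindep hSE,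
      hA.spanning_iff_exists_transversal hr hSE]
    rfl
  rw [hPolynomial_eq_sum_indep hE, setPolynomial]
  refine sum_nbij' (E \ ·) (E \ ·) (fun I hI => ?_) (fun S hS => ?_) (fun I hI => ?_)
    (fun S hS => ?_) fun I hI => ?_
  · obtain ⟨hIE, hI⟩ := mem_filter.1 hI
    rwa [hmem sdiff_subset, Finset.sdiff_sdiff_eq_self (mem_powerset.1 hIE)]
  · have hSE := (mem_hallSets.1 hS).1
    exact mem_filter.2 ⟨mem_powerset.2 sdiff_subset, (hmem hSE).1 hS⟩
  · exact Finset.sdiff_sdiff_eq_self (mem_powerset.1 (mem_filter.1 hI).1)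
  · exact Finset.sdiff_sdiff_eq_self (mem_hallSets.1 hS).1
  · have hIE := mem_powerset.1 (mem_filter.1 hI).1
    rw [Finset.sdiff_sdiff_eq_self hIE, card_sdiff_of_subset hIE, card_univ, Fintype.card_fin]
    congr 2
    lia

end HPolynomial

section Polytope

variable {α : Type*} {r : ℕ}

theorem convex_simplexWithOrigin (I : Finset (Fin r)) : Convex ℝ (simplexWithOrigin I) :=
  convex_convexHull ℝ _

theorem zero_mem_simplexWithOrigin (I : Finset (Fin r)) : 0 ∈ simplexWithOrigin I :=
  subset_convexHull ℝ _ (Set.mem_insert 0 _)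

theorem single_mem_simplexWithOrigin {I : Finset (Fin r)} {i : Fin r} (hi : i ∈ I) :
    Pi.single i 1 ∈ simplexWithOrigin I :=
  subset_convexHull ℝ _ (Set.mem_insert_of_mem 0 (Set.mem_image_of_mem _ hi))

theorem sum_le_of_mem_simplexWithOrigin {I : Finset (Fin r)} {x : Fin r → ℝ}
    (hx : x ∈ simplexWithOrigin I) (J : Finset (Fin r)) :
    ∑ j ∈ J, x j ≤ if Disjoint I J then 0 else 1 := by
  have hlinear : IsLinearMap ℝ fun x : Fin r → ℝ => ∑ j ∈ J, x j :=
    ⟨fun x y => sum_add_distrib, fun a x => (mul_sum J x a).symm⟩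
  refine convexHull_min ?_ (convex_halfSpace_le hlinear _) hx
  rintro _ (rfl | ⟨i, hi, rfl⟩)
  · simp only [Set.mem_ofPred_eq, Pi.zero_apply, sum_const_zero]
    split_ifs <;> norm_num
  · simp only [Set.mem_ofPred_eq, Pi.single_apply, sum_ite_eq']
    split_ifs with hiJ hIJ
    · exact absurd hiJ (disjoint_left.1 hIJ hi)
    all_goals norm_num

theorem card_smul_eq_sum {β F : Type*} [AddCommGroup F] [Module ℝ F] {K : Set F}
    (hK : Convex ℝ K) (hne : K.Nonempty) (s : Finset β) : (#s : ℝ) • K = ∑ _e ∈ s, K := by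
  classical
  induction s using Finset.induction_on with
  | empty => simp [Set.zero_smul_set hne]
  | insert e s he ih =>
    rw [sum_insert he, card_insert_of_notMem he, ← ih, Nat.cast_succ,
      hK.add_smul (Nat.cast_nonneg _) zero_le_one, one_smul, add_comm]

variable [DecidableEq α] {A : Fin r → Finset α} {E : Finset α} {m : Fin r →₀ ℕ}

theorem transversalhedron_eq_sum (A : Fin r → Finset α) (E : Finset α) :
    transversalhedron (E : Set α) (fun j => (A j : Set α)) =
      ∑ e ∈ E, simplexWithOrigin {j | e ∈ A j} := by
  rw [transversalhedron, ← sum_fiberwise E fun e => ({j | e ∈ A j} : Finset (Fin r))]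
  refine sum_congr rfl fun I _ => ?_
  have hcount : typeCount (E : Set α) (fun j => (A j : Set α)) I =
      #{e ∈ E | ({j | e ∈ A j} : Finset (Fin r)) = I} := by
    rw [typeCount, ← Set.ncard_coe_finset]
    congr 1
    ext e
    simp [Finset.ext_iff, iff_comm]
  rw [hcount, card_smul_eq_sum (convex_simplexWithOrigin I) ⟨0, zero_mem_simplexWithOrigin I⟩]
  exact sum_congr rfl fun e he => by rw [(mem_filter.1 he).2]

theorem sum_le_of_mem_transversalhedron {x : Fin r → ℝ}
    (hx : x ∈ transversalhedron (E : Set α) fun j => (A j : Set α)) (J : Finset (Fin r)) :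
    ∑ j ∈ J, x j ≤ #(E ∩ J.biUnion A) := by
  rw [transversalhedron_eq_sum, Set.mem_finsetSum] at hx
  obtain ⟨y, hy, rfl⟩ := hx
  calc ∑ j ∈ J, (∑ e ∈ E, y e) j = ∑ e ∈ E, ∑ j ∈ J, y e j := by
        simp_rw [Finset.sum_apply]
        exact sum_comm
    _ ≤ ∑ e ∈ E, if Disjoint ({j | e ∈ A j} : Finset (Fin r)) J then 0 else 1 :=
        sum_le_sum fun e he => sum_le_of_mem_simplexWithOrigin (hy he) J
    _ = #(E ∩ J.biUnion A) := by
        simp_rw [← ite_not (Disjoint _ _), sum_boole]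
        congr 2
        ext e
        simp [not_disjoint_iff, and_comm]

theorem exists_pairwise_disjoint_of_forall_sum_le {ι : Type*} {t : ι → Finset α} {c : ι → ℕ}
    (hc : ∀ J : Finset ι, ∑ j ∈ J, c j ≤ #(J.biUnion t)) :
    ∃ s : ι → Finset α,
      (Pairwise fun i j => Disjoint (s i) (s j)) ∧ ∀ j, s j ⊆ t j ∧ #(s j) = c j := by
  classical
  have hall (K : Finset (Σ j, Fin (c j))) : #K ≤ #(K.biUnion fun p => t p.1) :=
    calc #K ≤ #((K.image Sigma.fst).sigma fun _ => univ) :=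
          card_le_card fun p hp => mem_sigma.2 ⟨mem_image_of_mem _ hp, mem_univ _⟩
      _ ≤ #((K.image Sigma.fst).biUnion t) := by simpa using hc (K.image Sigma.fst)
      _ = #(K.biUnion fun p => t p.1) := by rw [image_biUnion]
  obtain ⟨g, hg, hgt⟩ := (all_card_le_biUnion_card_iff_exists_injective _).1 hall
  refine ⟨fun j => univ.image fun k => g ⟨j, k⟩, fun i j hij => ?_, fun j => ⟨?_, ?_⟩⟩
  · simp only [disjoint_left, mem_image, mem_univ, true_and]
    rintro _ ⟨k, rfl⟩ ⟨l, hl⟩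
    exact hij (congrArg Sigma.fst (hg hl)).symm
  · exact image_subset_iff.2 fun k _ => hgt ⟨j, k⟩
  · exact (card_image_of_injective _ (hg.comp sigma_mk_injective)).trans (card_fin _)

theorem mem_transversalhedron_of_forall_sum_le {c : Fin r → ℕ}
    (hc : ∀ J : Finset (Fin r), ∑ j ∈ J, c j ≤ #(E ∩ J.biUnion A)) :
    (fun j => (c j : ℝ)) ∈ transversalhedron (E : Set α) fun j => (A j : Set α) := by
  simp_rw [inter_biUnion] at hc
  obtain ⟨s, hdisj, hs⟩ := exists_pairwise_disjoint_of_forall_sum_le hc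
  have hmem (e : α) : ∑ j with e ∈ s j, Pi.single j 1 ∈ simplexWithOrigin {j | e ∈ A j} := by
    by_cases he : ∃ i, e ∈ s i
    · obtain ⟨i, hi⟩ := he
      have hunique : ({j | e ∈ s j} : Finset (Fin r)) = {i} := by
        ext j
        rw [mem_filter_univ, mem_singleton]
        refine ⟨fun hj => ?_, fun h => h ▸ hi⟩
        by_contra hne
        exact disjoint_left.1 (hdisj hne) hj hi
      rw [hunique, sum_singleton]
      exact single_mem_simplexWithOrigin (by simpa using (mem_inter.1 ((hs i).1 hi)).2)
    · rw [filter_false_of_mem fun j _ hj => he ⟨j, hj⟩, sum_empty]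
      exact zero_mem_simplexWithOrigin _
  have hsum : (fun j => (c j : ℝ)) = ∑ e ∈ E, ∑ j with e ∈ s j, Pi.single j 1 := by
    ext i
    have hi : E ∩ s i = s i := inter_eq_right.2 ((hs i).1.trans inter_subset_left)
    simp [Finset.sum_apply, Pi.single_apply, hi, (hs i).2]
  rw [hsum, transversalhedron_eq_sum]
  exact Set.finsetSum_mem_finsetSum _ _ _ fun e _ => hmem e

theorem mem_latticeMonomials_iff :
    m ∈ latticeMonomials (transversalhedron (E : Set α) fun j => (A j : Set α)) ↔
      IsHall (excess A E m) univ := by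
  simp only [IsHall, subset_univ, forall_const, excess_nonneg_iff]
  refine ⟨fun ⟨c, hc, _, hm⟩ J => ?_, fun h => ⟨fun j => m j + 1, ?_, fun j => by lia, by simp⟩⟩
  · have hcast (j) : (c j : ℝ) = (m j + 1 : ℕ) := by
      exact_mod_cast (eq_add_of_sub_eq (hm j).symm)
    have hle := sum_le_of_mem_transversalhedron hc J
    simp_rw [hcast] at hle
    exact_mod_cast hle
  · simpa using mem_transversalhedron_of_forall_sum_le h

theorem latticeMonomials_eq_hallMonomials :
    latticeMonomials (transversalhedron (E : Set α) fun j => (A j : Set α)) =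
      hallMonomials A univ E := by
  ext m
  simp [mem_latticeMonomials_iff, mem_hallMonomials]

theorem degree_add_of_maximal
    (hm : Maximal (· ∈ latticeMonomials (transversalhedron (E : Set α) fun j => (A j : Set α))) m) :
    m.degree + r = #(E ∩ univ.biUnion A) := by
  have hhall := mem_latticeMonomials_iff.1 hm.prop
  have htight (i) : ∃ J : Finset (Fin r), i ∈ J ∧ excess A E m J = 0 := by
    by_contra! hne
    have hlt : m < m + Finsupp.single i 1 := lt_add_of_pos_right m (by simp [pos_iff_ne_zero])
    refine hm.not_prop_of_gt hlt (mem_latticeMonomials_iff.2 fun J hJ => ?_)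
    rw [Finsupp.coe_add, Finsupp.single_eq_pi_single, excess_add_single]
    have hnonneg := hhall J hJ
    split_ifs with hi
    · have := hne J hi
      lia
    · rwa [add_zero]
  choose T hiT hT using htight
  have hunion (s : Finset (Fin r)) : excess A E m (s.biUnion T) = 0 := by
    induction s using Finset.induction_on with
    | empty => exact excess_empty
    | insert i s _ ih =>
      rw [biUnion_insert]
      exact (isSubmodular_excess E m).union_eq_zero hhall (subset_univ _) (subset_univ _) (hT i) ih
  have huniv : univ.biUnion T = univ :=
    eq_univ_iff_forall.2 fun i => mem_biUnion.2 ⟨i, mem_univ i, hiT i⟩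
  have hdegree := hunion univ
  rw [huniv, excess_eq_card_sub_degree (subset_univ _), card_univ, Fintype.card_fin] at hdegree
  lia

theorem degreeSequence_latticeMonomials (A : Fin r → Finset α) (E : Finset α) (k : ℕ) :
    (degreeSequence (latticeMonomials
      (transversalhedron (E : Set α) fun j => (A j : Set α))) k : ℤ) =
        (monomialPolynomial A univ E).coeff k := by
  have hfilter : {m ∈ (hallMonomials A univ E : Set (Fin r →₀ ℕ)) | m.degree = k} =
      {m ∈ hallMonomials A univ E | m.degree = k} := (coe_filter _ _).symm
  rw [degreeSequence, latticeMonomials_eq_hallMonomials, hfilter, Set.ncard_coe_finset,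
    monomialPolynomial, finsetSum_coeff]
  simp [coeff_X_pow, eq_comm]

end Polytope

theorem isPureOrderIdeal_latticeMonomials {α : Type*} {r : ℕ} (A : Fin r → Finset α)
    (E : Finset α) :
    IsPureOrderIdeal
      (latticeMonomials (transversalhedron (E : Set α) fun j => (A j : Set α))) where
  finite := by
    classical
    exact latticeMonomials_eq_hallMonomials (A := A) ▸ finite_toSet _
  dvd_closed m hm n hnm := by
    classical
    rw [mem_latticeMonomials_iff] at hm ⊢
    intro J hJ
    have hle : ∑ j ∈ J, (n j + 1) ≤ ∑ j ∈ J, (m j + 1) :=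
      sum_le_sum fun j _ => Nat.succ_le_succ (hnm j)
    exact excess_nonneg_iff.2 (hle.trans (excess_nonneg_iff.1 (hm J hJ)))
  pure m n hm hn := by
    classical
    have := degree_add_of_maximal hm
    have := degree_add_of_maximal hn
    lia

end Cotransversal

theorem mainTheorem2 {α : Type*} (M : Matroid α) [M.Finite]
    (hM : Cotransversal.IsCotransversal M) (r : ℕ) (hr : (Matroid.dual M).eRank = r) :
    (∃ A : Fin r → Set α, Cotransversal.IsPresentation (Matroid.dual M) A) ∧
    ∀ A : Fin r → Set α, Cotransversal.IsPresentation (Matroid.dual M) A →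
      Cotransversal.IsPureOrderIdeal
        (Cotransversal.latticeMonomials (Cotransversal.transversalhedron M.E A)) ∧
      ∀ k : ℕ,
        (Cotransversal.degreeSequence
          (Cotransversal.latticeMonomials (Cotransversal.transversalhedron M.E A)) k : ℤ) =
        Cotransversal.hVector M k := by
  classical
  obtain ⟨m, A₀, hA₀⟩ := hM
  refine ⟨hA₀.exists_of_eRank_eq hr, fun A hA => ?_⟩
  obtain ⟨E, hE⟩ := M.ground_finite.exists_finset_coe
  lift A to Fin r → Finset α using fun j => M.ground_finite.subset (hA.1 j)
  rw [← hE]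
  refine ⟨Cotransversal.isPureOrderIdeal_latticeMonomials A E, fun k => ?_⟩
  rw [Cotransversal.degreeSequence_latticeMonomials,
    ← Cotransversal.setPolynomial_eq_monomialPolynomial,
    ← Cotransversal.hPolynomial_eq_setPolynomial hA hr hE, Cotransversal.hVector]
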